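/- All structures are finite, relational, and have a non-empty universe; all vocabularies are finite. Let $\mathcal{L}^k$ be infinitary logic (arbitrary conjunctions and disjunctions) with $k$ variables. For a collection $\mathcal{Q}$ of generalized (Lindström) quantifiers $Q_{\mathcal K}$, where each $\mathcal{K}$ is an isomorphism-closed class of structures of a fixed vocabulary, let $\mathcal{L}(\mathcal{Q})=\bigcup_{k\in\mathbb{N}}\mathcal{L}^k(\mathcal{Q})$ be the extension of $\mathcal{L}=\bigcup_k\mathcal{L}^k$ by the quantifiers in $\mathcal{Q}$. The arity of $Q_{\mathcal K}$ is the maximum arity of a relation symbol in the vocabulary of $\mathcal{K}$. $Q_{\mathcal K}$ is a CSP quantifier if $\mathcal{K}$ is the class of all structures $\mathbf{A}$ that admit a homomorphism $\mathbf{A}\to\mathbf{B}$, for some fixed template $\mathbf{B}$. For $\ell\ge 3$ let $n^\ell$ be the partial function with $n^\ell(a_1,\dots,a_\ell)=a$ if at least $\ell-1$ of the $a_i$ are equal to $a$, and undefined if there is no such $a$. For a structure $\mathbf{B}$ let $n^\ell(\mathbf{B})$ be the structure with the same universe and the same vocabulary in which each relation symbol $R$ is interpreted by the set of all defined results of applying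 $n^\ell$ componentwise to $\ell$ tuples of $R^{\mathbf{B}}$. The quantifier $Q_{\mathcal K}$ is $\mathcal{N}^\ell$-closed if, whenever $\mathbf{B}\in\mathcal{K}$ and $\mathbf{A}$ is a structure with the same universe satisfying $R^{\mathbf{A}}\subseteq R^{\mathbf{B}}\cup R^{n^\ell(\mathbf{B})}$ for all relation symbols $R$, also $\mathbf{A}\in\mathcal{K}$. Let $\mathcal{Q}^{\mathcal{N}^\ell_{\mathrm{CSP}}}_r$ be the collection of all $\mathcal{N}^\ell$-closed CSP quantifiers of arity at most $r$. Write $\mathcal{L}(\mathcal{Q})\le\mathcal{L}(\mathcal{Q}')$ if every sentence of $\mathcal{L}(\mathcal{Q})$, in any vocabulary, is equivalent (on all structures of that vocabulary) to a sentence of $\mathcal{L}(\mathcal{Q}')$, and $\mathcal{L}(\mathcal{Q})\lneq\mathcal{L}(\mathcal{Q}')$ if moreover $\mathcal{L}(\mathcal{Q}')\not\le\mathcal{L}(\mathcal{Q})$. **Statement.** Let $r\ge\ell\ge 3$. Then there is an $r'>r$ such that $\mathcal{L}(\mathcal{Q}^{\mathcal{N}^\ell_{\mathrm{CSP}}}_{r})\lneq\mathcal{L}(\mathcal{Q}^{\mathcal{N}^\ell_{\mathrm{CSP}}}_{r'})$.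 Consequently, for fixed $\ell$ there is an infinite strict arity hierarchy: there is a strictly increasing sequence $r=r_0<r_1<r_2<\cdots$ such that $\mathcal{L}(\mathcal{Q}^{\mathcal{N}^\ell_{\mathrm{CSP}}}_{r_n})\lneq\mathcal{L}(\mathcal{Q}^{\mathcal{N}^\ell_{\mathrm{CSP}}}_{r_{n+1}})$ for all $n\in\mathbb{N}$. -/

import Mathlib

namespace GenQuant

open scoped FirstOrder

/-- A finite relational structure over the vocabulary `τ` with non-empty universe.
(Vocabularies are relational and finite; this is required wherever they are quantified over.) -/
structure FinStr (τ : FirstOrder.Language.{0, 0}) : Type 1 where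
  carrier : Type
  str : τ.Structure carrier
  finite : Finite carrier
  nonempty : Nonempty carrier

attribute [instance] FinStr.str FinStr.finite FinStr.nonempty

/-- The finite structure on the universe of `A` with prescribed relations, in a relational
vocabulary `τ` (possibly different from that of `A`). -/
def FinStr.withRel {σ : FirstOrder.Language.{0, 0}} (A : FinStr σ) (τ : FirstOrder.Language.{0, 0}) [τ.IsRelational]
    (rel : ∀ n : ℕ, τ.Relations n → Set (Fin n → A.carrier)) : FinStr τ where
  carrier := A.carrier
  str :=
    { funMap := fun {_} f _ => isEmptyElim f
      RelMap := fun {n} R x => x ∈ rel n R }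
  finite := A.finite
  nonempty := A.nonempty

/-- The interpretation of the relation symbol `R` in `A`. -/
def FinStr.relation {τ : FirstOrder.Language.{0, 0}} (A : FinStr τ) {n : ℕ} (R : τ.Relations n) :
    Set (Fin n → A.carrier) :=
  {x | FirstOrder.Language.Structure.RelMap R x}

/-- A generalized (Lindström) quantifier `Q_K`: a finite relational vocabulary together with an
isomorphism-closed class `K` of finite structures in it. -/
structure Quantifier : Type 1 where
  voc : FirstOrder.Language.{0, 0}
  relational : voc.IsRelational
  finite : Finite (Σ n : ℕ, voc.Relations n)
  K : Set (FinStr voc)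
  iso_closed : ∀ A B : FinStr voc, Nonempty (A.carrier ≃[voc] B.carrier) → A ∈ K → B ∈ K

attribute [instance] Quantifier.relational Quantifier.finite

/-- The arity of the quantifier (maximal arity of a relation symbol of its vocabulary) is at
most `r`. -/
def Quantifier.ArityLE (Q : Quantifier) (r : ℕ) : Prop :=
  ∀ n : ℕ, Nonempty (Q.voc.Relations n) → n ≤ r

/-- `CSP(B)`: the class of finite structures that map homomorphically to `B`. -/
def CSP {τ : FirstOrder.Language.{0, 0}} (B : FinStr τ) : Set (FinStr τ) :=
  {A | Nonempty (A.carrier →[τ] B.carrier)}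

def Quantifier.IsCSP (Q : Quantifier) : Prop :=
  ∃ B : FinStr Q.voc, Q.K = CSP B

/-- A family of `ℓ`-ary partial functions `p_A : A^ℓ → A`. -/
abbrev PartialFamily (ℓ : ℕ) : Type 1 :=
  ∀ A : Type, (Fin ℓ → A) →. A

/-- `p(R)`: the results of applying `p` columnwise to `ℓ` tuples of `R`, where defined. -/
def applyRel {ℓ n : ℕ} {A : Type} (p : (Fin ℓ → A) →. A) (R : Set (Fin n → A)) :
    Set (Fin n → A) :=
  {c | ∃ M : Fin ℓ → Fin n → A, (∀ i, M i ∈ R) ∧ ∀ j, c j ∈ p (fun i => M i j)}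

/-- `Q_K` is `P`-closed: whenever `B ∈ K` and `A ≤ B ∪ p_B(B)` (same universe, each relation of
`A` is contained in `R^B ∪ p_B(R^B)`), also `A ∈ K`. -/
def Quantifier.IsClosed {ℓ : ℕ} (P : PartialFamily ℓ) (Q : Quantifier) : Prop :=
  ∀ B ∈ Q.K, ∀ rel : (∀ n : ℕ, Q.voc.Relations n → Set (Fin n → B.carrier)),
    (∀ (n : ℕ) (R : Q.voc.Relations n),
      rel n R ⊆ B.relation R ∪ applyRel (P B.carrier) (B.relation R)) →
    B.withRel Q.voc rel ∈ Q.K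

/-- The partial near-unanimity family: the value at `a` is `b` if at least `ℓ - 1` of the inputs
are equal to `b`, and it is undefined if there is no such `b` (`b` is unique if `ℓ ≥ 3`, see
`mem_nearUnanimity`). -/
noncomputable def nearUnanimity (ℓ : ℕ) : PartialFamily ℓ := fun _ a =>
  ⟨∃ b, ℓ - 1 ≤ {i : Fin ℓ | a i = b}.ncard, fun h => h.choose⟩

theorem mem_nearUnanimity {ℓ : ℕ} (hℓ : 3 ≤ ℓ) {A : Type} (a : Fin ℓ → A) (b : A) :
    b ∈ nearUnanimity ℓ A a ↔ ℓ - 1 ≤ {i : Fin ℓ | a i = b}.ncard := by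
  constructor
  · rintro ⟨h, rfl⟩
    exact h.choose_spec
  · intro hb
    refine ⟨⟨b, hb⟩, ?_⟩
    have h : ∃ b, ℓ - 1 ≤ {i : Fin ℓ | a i = b}.ncard := ⟨b, hb⟩
    change h.choose = b
    by_contra hne
    have hd : Disjoint {i : Fin ℓ | a i = h.choose} {i : Fin ℓ | a i = b} := by
      rw [Set.disjoint_left]
      intro i hi hi'
      exact hne (hi.symm.trans hi')
    have h1 := Set.ncard_union_eq hd (Set.toFinite _) (Set.toFinite _)
    have h2 := Set.ncard_le_card ({i : Fin ℓ | a i = h.choose} ∪ {i : Fin ℓ | a i = b})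
    have h3 := h.choose_spec
    rw [Nat.card_eq_fintype_card, Fintype.card_fin] at h2
    omega

/-- The collection of all `N^ℓ`-closed CSP quantifiers of arity at most `r`. -/
def nuCSPQuantifiers (ℓ r : ℕ) : Set Quantifier :=
  {Q | Q.IsCSP ∧ Q.IsClosed (nearUnanimity ℓ) ∧ Q.ArityLE r}

/-- The formulas of vocabulary `σ` of `𝓛^k(𝒬)`: infinitary logic with the `k` variables `Fin k`,
conjunctions over arbitrary sets, and the generalized quantifiers in `𝒬`.
(Disjunctions and universal quantification are obtained by negation.) In the formula
`Q ȳ₁,…,ȳ_m (ψ₁,…,ψ_m)` each `ȳ_i` is a tuple of distinct variables. -/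
inductive Formula (σ : FirstOrder.Language.{0, 0}) (𝒬 : Set Quantifier) (k : ℕ) : Type 1
  | eq (x y : Fin k) : Formula σ 𝒬 k
  | rel {n : ℕ} (R : σ.Relations n) (x : Fin n → Fin k) : Formula σ 𝒬 k
  | not (φ : Formula σ 𝒬 k) : Formula σ 𝒬 k
  | conj (ι : Type) (φ : ι → Formula σ 𝒬 k) : Formula σ 𝒬 k
  | ex (x : Fin k) (φ : Formula σ 𝒬 k) : Formula σ 𝒬 k
  | quant (Q : Quantifier) (hQ : Q ∈ 𝒬)
      (y : ∀ n : ℕ, Q.voc.Relations n → Fin n → Fin k)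
      (hy : ∀ (n : ℕ) (R : Q.voc.Relations n), Function.Injective (y n R))
      (ψ : ∀ n : ℕ, Q.voc.Relations n → Formula σ 𝒬 k) : Formula σ 𝒬 k

namespace Formula

variable {σ : FirstOrder.Language.{0, 0}} {𝒬 : Set Quantifier} {k : ℕ}

/-- The set of free variables. -/
def free : Formula σ 𝒬 k → Set (Fin k)
  | eq x y => {x, y}
  | rel _ x => Set.range x
  | not φ => φ.free
  | conj ι φ => ⋃ i : ι, (φ i).free
  | ex x φ => φ.free \ {x}
  | quant Q _ y _ ψ => ⋃ (n : ℕ) (R : Q.voc.Relations n), (ψ n R).free \ Set.range (y n R)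

/-- Satisfaction `(A, α) ⊨ φ`. Here `Function.extend y b α` is the assignment `α[b/y]`. -/
def Realize (A : FinStr σ) : Formula σ 𝒬 k → (Fin k → A.carrier) → Prop
  | eq x y, α => α x = α y
  | rel R x, α => (fun i => α (x i)) ∈ A.relation R
  | not φ, α => ¬ φ.Realize A α
  | conj ι φ, α => ∀ i : ι, (φ i).Realize A α
  | ex x φ, α => ∃ a : A.carrier, φ.Realize A (Function.update α x a)
  | quant Q _ y _ ψ, α =>
      A.withRel Q.voc (fun n R => {b | (ψ n R).Realize A (Function.extend (y n R) b α)}) ∈ Q.K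

def IsSentence (φ : Formula σ 𝒬 k) : Prop := φ.free = ∅

/-- Truth of a sentence in a structure (for sentences the assignment is irrelevant). -/
def Holds (A : FinStr σ) (φ : Formula σ 𝒬 k) : Prop :=
  ∀ α : Fin k → A.carrier, φ.Realize A α

end Formula

/-- `𝓛(𝒬) ≤ 𝓛(𝒬')`, where `𝓛 = ⋃_k 𝓛^k`: every sentence of `𝓛(𝒬)`, in any finite relational
vocabulary, is equivalent on finite structures to a sentence of `𝓛(𝒬')`. -/
def LogicLE (𝒬 𝒬' : Set Quantifier) : Prop :=
  ∀ σ : FirstOrder.Language.{0, 0}, σ.IsRelational → Finite (Σ n : ℕ, σ.Relations n) →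
    ∀ (k : ℕ) (φ : Formula σ 𝒬 k), φ.IsSentence →
      ∃ (k' : ℕ) (φ' : Formula σ 𝒬' k'), φ'.IsSentence ∧
        ∀ A : FinStr σ, φ.Holds A ↔ φ'.Holds A

/-- `𝓛(𝒬)` is strictly weaker than `𝓛(𝒬')`. -/
def LogicLT (𝒬 𝒬' : Set Quantifier) : Prop :=
  LogicLE 𝒬 𝒬' ∧ ¬ LogicLE 𝒬' 𝒬

end GenQuant

namespace GenQuant

open scoped FirstOrder

/-! The witness is the CSP quantifier whose template has as relations all cosets of an MDS code `R`
of dimension `K = r + 4` and length `n = 3K`, so that `r' = 3(r + 4)`.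

Closure: if at every coordinate at least two of three tuples of a coset take the value of `c`, then
two of the tuples agree on at least `n / 3 ≥ K` coordinates. They are therefore equal, and `c`
equals both (`IsMDS.mem_of_near`).

Inexpressibility: a system of `N` constraints "`z` restricted to the scope of `e` lies in `d e + R`"
in `N` variables is encoded on `V × F` (`systemStr`). Counting gives an unsatisfiable `d`
(`exists_unsatisfiable`) and scopes with strong expansion (`exists_expanding`). The duplicator plays
the fibrewise shifts `(v, a) ↦ (v, a + y v)` to hide the difference between `0` and `d`: by
expansion, `y` can be chosen so that its values on the pebbled variables and on any `r` further ones
extend to solutions of every small subsystem (`Extendable.exists_extension`). Hence no sentence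
using quantifiers of arity at most `r` separates the satisfiable system from the unsatisfiable one
(`BackAndForth.realize_iff`). -/

/-! ### Maximum distance separable codes -/

/-- A code of length `n` in which any `K` coordinates can be prescribed, and such that codewords
are determined by any `K` coordinates. -/
structure IsMDS {F : Type} [AddCommGroup F] {n : ℕ} (K : ℕ) (R : AddSubgroup (Fin n → F)) :
    Prop where
  free : ∀ J : Finset (Fin n), J.card ≤ K → ∀ w : Fin n → F, ∃ z ∈ R, ∀ j ∈ J, z j = w j
  unique : ∀ J : Finset (Fin n), K ≤ J.card → ∀ z ∈ R, ∀ w ∈ R, (∀ j ∈ J, z j = w j) → z = w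

/-- Reed–Solomon codes. -/
theorem exists_isMDS {F : Type} [Field F] {n : ℕ} (α : Fin n ↪ F) (K : ℕ) :
    ∃ R : AddSubgroup (Fin n → F), IsMDS K R := by
  -- Codewords are the value tables of polynomials of degree below `K`: interpolation gives `free`,
  -- and counting roots gives `unique`.
  let ev : Polynomial F →ₗ[F] (Fin n → F) := LinearMap.pi fun i => Polynomial.leval (α i)
  refine ⟨((Polynomial.degreeLT F K).map ev).toAddSubgroup, ?_, ?_⟩
  · intro J hJ w
    refine ⟨ev (Lagrange.interpolate J α w), ?_, ?_⟩
    · refine ⟨_, ?_, rfl⟩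
      rw [SetLike.mem_coe, Polynomial.mem_degreeLT]
      exact (Lagrange.degree_interpolate_lt w α.injective.injOn).trans_le (by exact_mod_cast hJ)
    · intro j hj
      exact Lagrange.eval_interpolate_at_node w α.injective.injOn hj
  · rintro J hJ _ ⟨p, hp, rfl⟩ _ ⟨q, hq, rfl⟩ h
    rw [SetLike.mem_coe, Polynomial.mem_degreeLT] at hp hq
    have hc : K ≤ (J.map α).card := by simpa using hJ
    have hpq : p = q := by
      refine Polynomial.eq_of_degrees_lt_of_eval_finset_eq (J.map α)
        (hp.trans_le (by exact_mod_cast hc)) (hq.trans_le (by exact_mod_cast hc)) ?_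
      intro x hx
      obtain ⟨j, hj, rfl⟩ := Finset.mem_map.1 hx
      exact h j hj
    rw [hpq]

theorem IsMDS.card_le {F : Type} [AddCommGroup F] [Finite F] {n K : ℕ}
    {R : AddSubgroup (Fin n → F)} (hR : IsMDS K R) (hK : K ≤ n) :
    Nat.card R ≤ Nat.card F ^ K := by
  have h : Function.Injective
      (fun (z : R) (i : Fin K) => (z : Fin n → F) (Fin.castLE hK i)) := by
    intro z w hzw
    refine Subtype.ext (hR.unique (Finset.univ.map (Fin.castLEEmb hK)) (by simp) _ z.2 _ w.2 ?_)
    intro j hj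
    obtain ⟨i, -, rfl⟩ := Finset.mem_map.1 hj
    exact congrFun hzw i
  have := Nat.card_le_card_of_injective _ h
  simpa [Nat.card_fun] using this

/-- Three tuples in a coset of a code of length at least `3K`, that differ from
`c` in pairwise disjoint sets of coordinates: then `c` is in the coset. -/
theorem IsMDS.mem_of_near {F : Type} [AddCommGroup F] {n K : ℕ}
    {R : AddSubgroup (Fin n → F)} (hR : IsMDS K R) (hn : 3 * K ≤ n) (d c : Fin n → F)
    (M : Fin 3 → Fin n → F) (hM : ∀ a, M a - d ∈ R)
    (hc : ∀ j, ∀ a b, a ≠ b → M a j = c j ∨ M b j = c j) : c - d ∈ R := by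
  classical
  have key : ∀ a b, a ≠ b → M a = M b → c - d ∈ R := by
    intro a b hab h
    have : c = M a := by
      funext j
      rcases hc j a b hab with h' | h'
      · exact h'.symm
      · rw [h]; exact h'.symm
    rw [this]; exact hM a
  have agree : ∀ a b, K ≤ (Finset.univ.filter fun j => M a j = M b j).card → M a = M b := by
    intro a b h
    have := hR.unique _ h _ (hM a) _ (hM b) (by
      intro j hj
      simpa using hj)
    simpa using this
  -- At each coordinate two of the three rows equal `c`, hence each other. As `3 * K ≤ n`, one of
  -- the three agreement sets has at least `K` elements.
  have cover : (Finset.univ : Finset (Fin n)) ⊆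
      (Finset.univ.filter fun j => M 0 j = M 1 j) ∪
        ((Finset.univ.filter fun j => M 0 j = M 2 j) ∪
          (Finset.univ.filter fun j => M 1 j = M 2 j)) := by
    intro j _
    have h01 := hc j 0 1 (by decide)
    have h02 := hc j 0 2 (by decide)
    have h12 := hc j 1 2 (by decide)
    simp only [Finset.mem_union, Finset.mem_filter, Finset.mem_univ, true_and]
    grind
  have h1 := Finset.card_le_card cover
  have h2 := Finset.card_union_le (Finset.univ.filter fun j => M 0 j = M 1 j)
    ((Finset.univ.filter fun j => M 0 j = M 2 j) ∪ (Finset.univ.filter fun j => M 1 j = M 2 j))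
  have h3 := Finset.card_union_le (Finset.univ.filter fun j => M 0 j = M 2 j)
    (Finset.univ.filter fun j => M 1 j = M 2 j)
  rw [Finset.card_univ, Fintype.card_fin] at h1
  rcases lt_or_ge (Finset.univ.filter fun j => M 0 j = M 1 j).card K with a | a
  · rcases lt_or_ge (Finset.univ.filter fun j => M 0 j = M 2 j).card K with b | b
    · exact key 1 2 (by decide) (agree _ _ (by omega))
    · exact key 0 2 (by decide) (agree _ _ b)
  · exact key 0 1 (by decide) (agree _ _ a)

/-! ### Expanding constraint hypergraphs -/

/-- The variables occurring in the constraints of `S`. -/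
def varsOf {E V : Type} [DecidableEq V] {n : ℕ} (f : E → Fin n → V) (S : Finset E) : Finset V :=
  (S ×ˢ Finset.univ).image fun q => f q.1 q.2

/-- Sets of at most `g` constraints have at least `n - 2` variables per constraint. -/
def Expanding {E V : Type} [DecidableEq V] {n : ℕ} (f : E → Fin n → V) (g : ℕ) : Prop :=
  ∀ S : Finset E, S.card ≤ g → (n - 2) * S.card ≤ (varsOf f S).card

/-- A map sending `s` constraints into `M` variables is coded by those constraints, the list of
variables, the incidences, and its values elsewhere. The factor `(N ^ n) ^ s` fills the `s` freed
rows with arbitrary values `u`, which avoids the exponent `N - s`. -/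
theorem card_collapsing_mul_le (N n s M : ℕ) :
    Nat.card {f : Fin N → Fin n → Fin N // ∃ (σ : Fin s ↪ Fin N) (w : Fin M → Fin N)
      (t : Fin s → Fin n → Fin M), ∀ j i, f (σ j) i = w (t j i)} * (N ^ n) ^ s ≤
      N ^ s * N ^ M * ((M ^ n) ^ s * (N ^ n) ^ N) := by
  classical
  let X := (Fin s → Fin N) × (Fin M → Fin N) × (Fin s → Fin n → Fin M) ×
    (Fin N → Fin n → Fin N)
  have hle : Nat.card ({f : Fin N → Fin n → Fin N // ∃ (σ : Fin s ↪ Fin N) (w : Fin M → Fin N)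
      (t : Fin s → Fin n → Fin M), ∀ j i, f (σ j) i = w (t j i)} × (Fin s → Fin n → Fin N)) ≤
      Nat.card X := by
    choose σ w t h using fun (f : {f : Fin N → Fin n → Fin N // ∃ (σ : Fin s ↪ Fin N)
      (w : Fin M → Fin N) (t : Fin s → Fin n → Fin M), ∀ j i, f (σ j) i = w (t j i)}) => f.2
    refine Nat.card_le_card_of_injective (fun q => ((fun j => σ q.1 j, w q.1, t q.1,
      Function.extend (σ q.1) q.2 q.1.1) : X)) ?_
    rintro ⟨f, u⟩ ⟨f', u'⟩ heq
    simp only [X, Prod.mk.injEq] at heq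
    obtain ⟨h1, h2, h3, h4⟩ := heq
    have h1' : σ f = σ f' := by
      ext j
      exact congrArg _ (congrFun h1 j)
    have hu : u = u' := by
      funext j
      have := congrFun h4 (σ f j)
      rw [(σ f).injective.extend_apply, h1', (σ f').injective.extend_apply] at this
      exact this
    refine Prod.ext (Subtype.ext ?_) hu
    funext e
    by_cases he : ∃ j, σ f j = e
    · obtain ⟨j, rfl⟩ := he
      funext i
      change f.1 (σ f j) i = f'.1 (σ f j) i
      rw [h f, h1', h f', h2, h3]
    · have := congrFun h4 e
      rwa [Function.extend_apply' _ _ _ he,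
        Function.extend_apply' _ _ _ (by rwa [h1'] at he)] at this
  rw [Nat.card_prod] at hle
  simp only [X, Nat.card_prod, Nat.card_fun, Nat.card_fin] at hle
  calc _ ≤ _ := hle
    _ = _ := by ring

theorem exists_collapsing_of_not_expanding {N n g : ℕ} {f : Fin N → Fin n → Fin N}
    (hf : ¬ Expanding f g) : ∃ s ∈ Finset.Icc 1 g, ∃ (σ : Fin s ↪ Fin N)
      (w : Fin ((n - 2) * s) → Fin N) (t : Fin s → Fin n → Fin ((n - 2) * s)),
      ∀ j i, f (σ j) i = w (t j i) := by
  classical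
  unfold Expanding at hf
  push Not at hf
  obtain ⟨S, hS, hlt⟩ := hf
  have hpos : 0 < S.card := by
    rcases Nat.eq_zero_or_pos S.card with h | h
    · rw [h] at hlt; omega
    · exact h
  have : Nonempty (Fin N) := let ⟨e, _⟩ := Finset.card_pos.1 hpos; ⟨e⟩
  refine ⟨S.card, Finset.mem_Icc.2 ⟨hpos, hS⟩, (S.orderEmbOfFin rfl).toEmbedding, ?_⟩
  obtain ⟨ι⟩ : Nonempty (varsOf f S ↪ Fin ((n - 2) * S.card)) :=
    Function.Embedding.nonempty_of_card_le (by simpa using hlt.le)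
  have hmem : ∀ j i, f (S.orderEmbOfFin rfl j) i ∈ varsOf f S := fun j i =>
    Finset.mem_image.2 ⟨(_, i), Finset.mem_product.2
      ⟨S.orderEmbOfFin_mem rfl j, Finset.mem_univ _⟩, rfl⟩
  refine ⟨Function.extend ι Subtype.val fun _ => Classical.arbitrary _,
    fun j i => ι ⟨_, hmem j i⟩, fun j i => ?_⟩
  rw [ι.injective.extend_apply]
  rfl

theorem exists_expanding (n g : ℕ) (hn : 2 ≤ n) :
    ∃ N : ℕ, 0 < N ∧ ∃ f : Fin N → Fin n → Fin N, Expanding f g := by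
  classical
  -- The proportion of maps with a violating set of size `s` is at most `c s / N ^ s ≤ c s / N`,
  -- since the exponents leave `n * s - s - (n - 2) * s = s`. With `N` above the sum of the `c s`,
  -- some map has no violating set.
  let c : ℕ → ℕ := fun s => (((n - 2) * s) ^ n) ^ s
  let N := ∑ s ∈ Finset.Icc 1 g, c s + 1
  refine ⟨N, Nat.succ_pos _, ?_⟩
  by_contra! hbad
  let B : ℕ → Finset (Fin N → Fin n → Fin N) := fun s => Finset.univ.filter fun f =>
    ∃ (σ : Fin s ↪ Fin N) (w : Fin ((n - 2) * s) → Fin N)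
      (t : Fin s → Fin n → Fin ((n - 2) * s)), ∀ j i, f (σ j) i = w (t j i)
  have hB : ∀ s ∈ Finset.Icc 1 g, (B s).card * N ≤ c s * (N ^ n) ^ N := by
    intro s hs
    have h := card_collapsing_mul_le N n s ((n - 2) * s)
    rw [Nat.card_eq_fintype_card, Fintype.card_subtype] at h
    have hNpos : 0 < N := Nat.succ_pos _
    have e : (N ^ n) ^ s = N ^ s * N ^ ((n - 2) * s) * N ^ s := by
      rw [← pow_mul, ← pow_add, ← pow_add]
      congr 1
      obtain ⟨k, rfl⟩ := Nat.exists_eq_add_of_le hn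
      rw [Nat.add_sub_cancel_left]
      ring
    have h' : (N ^ s * N ^ ((n - 2) * s)) * ((B s).card * N ^ s) ≤
        (N ^ s * N ^ ((n - 2) * s)) * (c s * (N ^ n) ^ N) := by
      calc _ = (B s).card * (N ^ n) ^ s := by rw [e]; ring
        _ ≤ _ := h
    have h'' := Nat.le_of_mul_le_mul_left h' (by positivity)
    refine le_trans (Nat.mul_le_mul_left _ ?_) h''
    exact Nat.le_self_pow (by have := (Finset.mem_Icc.1 hs).1; omega) N
  have hcov : (Finset.univ : Finset (Fin N → Fin n → Fin N)) ⊆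
      (Finset.Icc 1 g).biUnion B := by
    intro f _
    obtain ⟨s, hs, h⟩ := exists_collapsing_of_not_expanding (hbad f)
    exact Finset.mem_biUnion.2 ⟨s, hs, Finset.mem_filter.2 ⟨Finset.mem_univ _, h⟩⟩
  have h1 := (Finset.card_le_card hcov).trans Finset.card_biUnion_le
  have h2 : (N ^ n) ^ N * N ≤ (∑ s ∈ Finset.Icc 1 g, c s) * (N ^ n) ^ N := by
    calc (N ^ n) ^ N * N ≤ (∑ s ∈ Finset.Icc 1 g, (B s).card) * N := by
          refine Nat.mul_le_mul_right _ (le_trans (le_of_eq ?_) h1)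
          simp
      _ = ∑ s ∈ Finset.Icc 1 g, (B s).card * N := Finset.sum_mul _ _ _
      _ ≤ ∑ s ∈ Finset.Icc 1 g, c s * (N ^ n) ^ N := Finset.sum_le_sum hB
      _ = _ := (Finset.sum_mul _ _ _).symm
  rw [mul_comm] at h2
  have h3 := Nat.le_of_mul_le_mul_right h2 (by positivity)
  exact absurd h3 (by simp [N])

/-! ### Private positions and peeling -/

section Peeling

variable {E V : Type} [DecidableEq E] [DecidableEq V] {n : ℕ} (f : E → Fin n → V)

/-- The positions of `e` carrying a variable outside `P` with no other occurrence in `S`. -/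
noncomputable def privatePos (S : Finset E) (P : Finset V) (e : E) : Finset (Fin n) :=
  open Classical in
  Finset.univ.filter fun i => f e i ∉ P ∧ ∀ e' ∈ S, ∀ i', f e' i' = f e i → e' = e ∧ i' = i

theorem mem_privatePos {S : Finset E} {P : Finset V} {e : E} {i : Fin n} :
    i ∈ privatePos f S P e ↔
      f e i ∉ P ∧ ∀ e' ∈ S, ∀ i', f e' i' = f e i → e' = e ∧ i' = i := by
  classical
  simp [privatePos]

theorem privatePos_anti {S S' : Finset E} (h : S ⊆ S') (P : Finset V) (e : E) :
    privatePos f S' P e ⊆ privatePos f S P e := by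
  intro i hi
  rw [mem_privatePos] at hi ⊢
  exact ⟨hi.1, fun e' he' => hi.2 e' (h he')⟩

/-- Double counting: a variable of `S` outside `P` occurs at least twice in `S`, or its only
occurrence is private and is counted once more. -/
theorem two_mul_card_varsOf_le (S : Finset E) (P : Finset V) :
    2 * (varsOf f S).card ≤
      2 * P.card + (∑ e ∈ S, (privatePos f S P e).card) + n * S.card := by
  classical
  let D : Finset (E × Fin n) := S ×ˢ Finset.univ
  let D' : Finset (E × Fin n) := D.filter fun q => q.2 ∈ privatePos f S P q.1
  let W := varsOf f S \ P
  have hD : D.card = n * S.card := by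
    simp [D, Finset.card_product, mul_comm]
  have hD' : D'.card = ∑ e ∈ S, (privatePos f S P e).card := by
    rw [← Finset.card_sigma]
    refine Finset.card_bij (fun q _ => ⟨q.1, q.2⟩) ?_ ?_ ?_
    · rintro ⟨e, i⟩ h
      simpa [D', D] using h
    · rintro ⟨e, i⟩ _ ⟨e', i'⟩ _ h
      simpa using h
    · rintro ⟨e, i⟩ h
      exact ⟨(e, i), by simpa [D', D] using h, rfl⟩
  have hW : (varsOf f S).card ≤ P.card + W.card := by
    have := Finset.card_le_card_sdiff_add_card (s := varsOf f S) (t := P)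
    simp only [W]
    omega
  have hfib : ∀ v ∈ W, 2 ≤ (D.filter fun q => f q.1 q.2 = v).card +
      (D'.filter fun q => f q.1 q.2 = v).card := by
    intro v hv
    obtain ⟨hv1, hv2⟩ := Finset.mem_sdiff.1 hv
    obtain ⟨q, hq, rfl⟩ := Finset.mem_image.1 hv1
    have hqf : q ∈ D.filter fun q' => f q'.1 q'.2 = f q.1 q.2 := by
      exact Finset.mem_filter.2 ⟨hq, rfl⟩
    have hpos := Finset.card_pos.2 ⟨q, hqf⟩
    by_cases h1 : (D.filter fun q' => f q'.1 q'.2 = f q.1 q.2).card = 1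
    · have hq' : q ∈ D'.filter fun q' => f q'.1 q'.2 = f q.1 q.2 := by
        refine Finset.mem_filter.2 ⟨Finset.mem_filter.2 ⟨hq, ?_⟩, rfl⟩
        rw [mem_privatePos]
        refine ⟨hv2, fun e' he' i' h => ?_⟩
        have : (e', i') = q := Finset.card_le_one.1 h1.le _
          (Finset.mem_filter.2 ⟨Finset.mem_product.2 ⟨he', Finset.mem_univ _⟩, h⟩) _ hqf
        rw [← this]
        exact ⟨rfl, rfl⟩
      have := Finset.card_pos.2 ⟨q, hq'⟩
      omega
    · omega
  have hs := Finset.sum_le_sum hfib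
  rw [Finset.sum_add_distrib, Finset.sum_const, smul_eq_mul] at hs
  have hA : ∀ X : Finset (E × Fin n),
      ∑ v ∈ W, (X.filter fun q => f q.1 q.2 = v).card ≤ X.card := by
    intro X
    rw [← Finset.card_biUnion]
    · exact Finset.card_le_card (Finset.biUnion_subset.2 fun v _ => Finset.filter_subset _ _)
    · intro a _ b _ hab
      rw [Function.onFun, Finset.disjoint_left]
      intro q hq hq'
      exact hab ((Finset.mem_filter.1 hq).2.symm.trans (Finset.mem_filter.1 hq').2)
  have := hA D
  have := hA D'
  omega

/-- Every constraint of `S` has at least five positions that are not private. -/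
def Dense (P : Finset V) (S : Finset E) : Prop :=
  ∀ e ∈ S, (privatePos f S P e).card + 5 ≤ n

/-- Expansion and double counting give `2(n - 2)|S| ≤ 2|P| + (n - 5)|S| + n|S|`, and the right side
has only `2n - 5` per constraint. -/
theorem Dense.card_le {P : Finset V} {S : Finset E} {g : ℕ} (hS : Dense f P S)
    (hf : Expanding f g) (hg : S.card ≤ g) : S.card ≤ 2 * P.card := by
  rcases S.eq_empty_or_nonempty with rfl | ⟨e, he⟩
  · simp
  have hn : 5 ≤ n := (Nat.le_add_left _ _).trans (hS e he)
  have h1 := two_mul_card_varsOf_le f S P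
  have h2 := hf S hg
  have h3 : ∑ e ∈ S, (privatePos f S P e).card ≤ S.card * (n - 5) := by
    rw [← smul_eq_mul]
    exact Finset.sum_le_card_nsmul _ _ _ fun e he => by have := hS e he; omega
  obtain ⟨k, rfl⟩ := Nat.exists_eq_add_of_le hn
  rw [Nat.add_sub_cancel_left] at h3
  rw [show 5 + k - 2 = k + 3 by omega] at h2
  nlinarith

theorem exists_maximal_dense [Finite E] (P : Finset V) (g : ℕ) :
    ∃ C : Finset E, Dense f P C ∧ C.card ≤ g ∧
      ∀ S, C ⊆ S → S.card ≤ g → Dense f P S → S = C := by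
  classical
  have := Fintype.ofFinite E
  obtain ⟨C, hC, hmax⟩ := Finset.exists_max_image
    ((Finset.univ : Finset (Finset E)).filter fun S => Dense f P S ∧ S.card ≤ g) Finset.card
    ⟨∅, Finset.mem_filter.2 ⟨Finset.mem_univ _, by simp [Dense], by simp⟩⟩
  simp only [Finset.mem_filter, Finset.mem_univ, true_and] at hC hmax
  exact ⟨C, hC.1, hC.2, fun S hCS hS hd =>
    (Finset.eq_of_subset_of_card_le hCS (hmax S ⟨hd, hS⟩)).symm⟩

/-! ### Extending partial assignments to local solutions -/

variable {F : Type} [AddCommGroup F] (R : AddSubgroup (Fin n → F)) (d : E → Fin n → F)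

/-- The assignment `z` satisfies the constraint `e`, with right-hand side `d e`. -/
def Sat (z : V → F) (e : E) : Prop := (fun i => z (f e i)) - d e ∈ R

/-- A maximal dense set of constraints is no obstacle to satisfying further ones, while keeping
the values of `P` and of `r` further variables. -/
theorem exists_sat_of_maximal_dense {r g : ℕ} (hR : IsMDS (r + 4) R) {P T : Finset V}
    (hT : T.card ≤ r) {C : Finset E} (hC : Dense f P C)
    (hmax : ∀ S, C ⊆ S → S.card ≤ g → Dense f P S → S = C) {y : V → F}
    (hy : ∀ e ∈ C, Sat f R d y e) (k : ℕ) :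
    ∀ S, C ⊆ S → S.card ≤ g → S.card = k → ∃ z : V → F, (∀ v ∈ P ∪ T, z v = y v) ∧
      ∀ e ∈ S, Sat f R d z e := by
  classical
  induction k with
  | zero =>
    intro S _ _ hk
    rw [Finset.card_eq_zero.1 hk]
    exact ⟨y, fun _ _ => rfl, by simp⟩
  | succ k ih =>
    intro S hCS hSg hk
    by_cases hSC : S = C
    · exact ⟨y, fun _ _ => rfl, hSC ▸ hy⟩
    have hnd : ¬ Dense f P S := fun h => hSC (hmax S hCS hSg h)
    unfold Dense at hnd
    push Not at hnd
    -- `e` has at least `n - 4` private positions. It lies outside `C`, where even fewer competing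
    -- constraints leave at most `n - 5`. So `e` can be removed, the rest solved, and `z'` repaired
    -- on private variables only.
    obtain ⟨e, he, hlt⟩ := hnd
    have heC : e ∉ C := fun h => by
      have h1 := hC e h
      have h2 := Finset.card_le_card (privatePos_anti f hCS P e)
      omega
    have hcard := Finset.card_erase_of_mem he
    obtain ⟨z', hz', hsat⟩ := ih (S.erase e)
      (fun x hx => Finset.mem_erase.2 ⟨fun h => heC (h ▸ hx), hCS hx⟩) (by omega) (by omega)
    -- The positions free to change. Private positions carry distinct variables, so `T` blocks at
    -- most `r` of them and at most `4 + r` positions stay fixed, which is the dimension of `R`.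
    let I := (privatePos f S P e).filter fun i => f e i ∉ T
    have hIP : ∀ i ∈ I, f e i ∉ P ∪ T ∧
        ∀ e' ∈ S, ∀ i', f e' i' = f e i → e' = e ∧ i' = i := by
      intro i hi
      obtain ⟨h1, h2⟩ := Finset.mem_filter.1 hi
      rw [mem_privatePos] at h1
      exact ⟨by simp [h1.1, h2], h1.2⟩
    have hI : (privatePos f S P e).card ≤ I.card + r := by
      have h1 := Finset.card_filter_add_card_filter_not (s := privatePos f S P e)
        (fun i => f e i ∈ T)
      have h2 : ((privatePos f S P e).filter fun i => f e i ∈ T).card ≤ T.card := by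
        refine Finset.card_le_card_of_injOn (f e) (fun i hi => (Finset.mem_filter.1 hi).2) ?_
        intro i hi j hj hij
        have hj' := (mem_privatePos f).1 (Finset.mem_filter.1 hj).1
        exact (hj'.2 e he i hij).2
      simp only [I]
      omega
    have hIc : Iᶜ.card ≤ r + 4 := by
      rw [Finset.card_compl, Fintype.card_fin]
      omega
    obtain ⟨u, hu, huz⟩ := hR.free Iᶜ hIc fun i => z' (f e i) - d e i
    let z : V → F := fun v => if h : ∃ i ∈ I, f e i = v then u h.choose + d e h.choose else z' v
    have hzI : ∀ i, z (f e i) = u i + d e i := by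
      intro i
      by_cases h : ∃ j ∈ I, f e j = f e i
      · have hc := h.choose_spec
        have : i = h.choose := ((hIP _ hc.1).2 e he i hc.2.symm).2
        simp only [z, dif_pos h]
        rw [← this]
      · simp only [z, dif_neg h]
        rw [huz i (Finset.mem_compl.2 fun hi => h ⟨i, hi, rfl⟩), sub_add_cancel]
    refine ⟨z, fun v hv => ?_, fun e' he' => ?_⟩
    · have h : ¬ ∃ i ∈ I, f e i = v := by
        rintro ⟨i, hi, rfl⟩
        exact (hIP i hi).1 hv
      simp only [z, dif_neg h]
      exact hz' v hv
    · by_cases hee : e' = e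
      · subst hee
        have : (fun i => z (f e' i)) - d e' = u := by
          funext i
          simp [hzI]
        rw [Sat, this]
        exact hu
      · have : (fun i => z (f e' i)) = fun i => z' (f e' i) := by
          funext i
          have h : ¬ ∃ j ∈ I, f e j = f e' i := by
            rintro ⟨j, hj, hji⟩
            exact hee ((hIP j hj).2 e' he' i hji.symm).1
          simp only [z, dif_neg h]
        rw [Sat, this]
        exact hsat e' (Finset.mem_erase.2 ⟨hee, he'⟩)

/-- The values of `x` on `P` extend to solutions of all small sets of constraints. -/
def Extendable (P : Finset V) (x : V → F) : Prop :=
  ∀ S : Finset E, S.card ≤ 2 * P.card → ∃ z : V → F, (∀ v ∈ P, z v = x v) ∧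
    ∀ e ∈ S, Sat f R d z e

/-- The assignment `y` must work for all `T` at once, since the duplicator commits to a bijection
before `T` is known. It is a solution of a maximal dense set `C`, which exists because `|C| ≤ 2|P|`.
The bound `4 * m` covers `C ∪ S`, both of size at most `2 * m`. -/
theorem Extendable.exists_extension [Finite E] {r m : ℕ} (hR : IsMDS (r + 4) R)
    (hf : Expanding f (4 * m)) {P : Finset V} (hP : P.card ≤ m) {x : V → F}
    (hx : Extendable f R d P x) :
    ∃ y : V → F, (∀ v ∈ P, y v = x v) ∧ ∀ T : Finset V, T.card ≤ r →
      ∀ P' ⊆ P ∪ T, P'.card ≤ m → Extendable f R d P' y := by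
  obtain ⟨C, hC, hCg, hmax⟩ := exists_maximal_dense f P (4 * m)
  have hC2 := hC.card_le f hf hCg
  obtain ⟨y, hyx, hy⟩ := hx C hC2
  refine ⟨y, hyx, fun T hT P' hP' hPm S hS => ?_⟩
  obtain ⟨z, hz, hsat⟩ := exists_sat_of_maximal_dense f R d hR hT hC hmax hy _ (C ∪ S)
    Finset.subset_union_left ((Finset.card_union_le _ _).trans (by omega)) rfl
  exact ⟨z, fun v hv => hz v (hP' hv), fun e he => hsat e (Finset.mem_union_right _ he)⟩

end Peeling

/-- A right-hand side `d` with a solution is determined by the solution and the residual codewords.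
With as many variables as constraints this leaves at most `|F| ^ ((K + 1)|E|)` of the `|F| ^ (n|E|)`
right-hand sides. -/
theorem exists_unsatisfiable {E V F : Type} [Fintype E] [Fintype V] [AddCommGroup F] [Finite F]
    [Nontrivial F] {n K : ℕ} (f : E → Fin n → V) (R : AddSubgroup (Fin n → F)) (hR : IsMDS K R) (hK : K + 2 ≤ n) (hE : Fintype.card V = Fintype.card E)
    (hpos : 0 < Fintype.card E) :
    ∃ d : E → Fin n → F, ∀ z : V → F, ∃ e, ¬ Sat f R d z e := by
  by_contra! h
  choose z hz using h
  have hinj : Function.Injective (fun d : E → Fin n → F =>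
      ((z d, fun e => ⟨_, hz d e⟩) : (V → F) × (E → R))) := by
    intro d d' hdd
    simp only [Prod.mk.injEq] at hdd
    obtain ⟨h1, h2⟩ := hdd
    funext e
    have := congrArg Subtype.val (congrFun h2 e)
    simp only [h1] at this
    exact sub_right_injective this
  have hle := Nat.card_le_card_of_injective _ hinj
  have hRc := hR.card_le (by omega)
  have hF : 1 < Nat.card F := Finite.one_lt_card
  simp only [Nat.card_prod, Nat.card_fun] at hle
  simp only [Nat.card_eq_fintype_card (α := V), Nat.card_eq_fintype_card (α := E),
    Nat.card_eq_fintype_card (α := Fin n), Fintype.card_fin, hE] at hle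
  have h1 : Nat.card F ^ Fintype.card E * Nat.card R ^ Fintype.card E ≤
      (Nat.card F ^ (K + 1)) ^ Fintype.card E := by
    rw [← mul_pow]
    refine Nat.pow_le_pow_left ?_ _
    rw [pow_succ, mul_comm]
    exact Nat.mul_le_mul_right _ hRc
  have h2 : (Nat.card F ^ (K + 1)) ^ Fintype.card E < (Nat.card F ^ n) ^ Fintype.card E :=
    Nat.pow_lt_pow_left (Nat.pow_lt_pow_right hF (by omega)) hpos.ne'
  omega

/-! ### Formulas -/

namespace Formula

variable {σ : FirstOrder.Language.{0, 0}} {𝒬 : Set Quantifier} {k : ℕ}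

theorem realize_congr (A : FinStr σ) (φ : Formula σ 𝒬 k) :
    ∀ α β : Fin k → A.carrier, (∀ i ∈ φ.free, α i = β i) → (φ.Realize A α ↔ φ.Realize A β) := by
  induction φ with
  | eq x y =>
    intro α β h
    simp only [Realize, h x (by simp [free]), h y (by simp [free])]
  | rel R x =>
    intro α β h
    have : (fun i => α (x i)) = fun i => β (x i) := funext fun i => h _ ⟨i, rfl⟩
    simp only [Realize, this]
  | not φ ih =>
    intro α β h
    exact not_congr (ih α β h)
  | conj ι φ ih =>
    intro α β h
    exact forall_congr' fun i => ih i α β fun j hj => h j (Set.mem_iUnion.2 ⟨i, hj⟩)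
  | ex x φ ih =>
    intro α β h
    refine exists_congr fun a => ih _ _ fun i hi => ?_
    by_cases hx : i = x
    · subst hx; simp
    · rw [Function.update_of_ne hx, Function.update_of_ne hx]
      exact h i ⟨hi, hx⟩
  | quant Q hQ y hy ψ ih =>
    intro α β h
    have : (fun n R => {b | (ψ n R).Realize A (Function.extend (y n R) b α)}) =
        fun n R => {b | (ψ n R).Realize A (Function.extend (y n R) b β)} := by
      funext n R
      ext b
      refine ih n R _ _ fun i hi => ?_
      by_cases hx : ∃ j, y n R j = i
      · obtain ⟨j, rfl⟩ := hx
        rw [(hy n R).extend_apply, (hy n R).extend_apply]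
      · rw [Function.extend_apply' _ _ _ hx, Function.extend_apply' _ _ _ hx]
        exact h i (Set.mem_iUnion₂.2 ⟨n, R, hi, hx⟩)
    simp only [Realize, this]

theorem IsSentence.holds_iff {φ : Formula σ 𝒬 k} (hφ : φ.IsSentence) (A : FinStr σ)
    (α : Fin k → A.carrier) : φ.Holds A ↔ φ.Realize A α :=
  ⟨fun h => h α, fun h β => (realize_congr A φ α β fun i hi => by
    rw [hφ] at hi; exact hi.elim).1 h⟩

/-- Formulas over a larger collection of quantifiers. -/
def mono {𝒬' : Set Quantifier} (h : 𝒬 ⊆ 𝒬') : Formula σ 𝒬 k → Formula σ 𝒬' k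
  | eq x y => eq x y
  | rel R x => rel R x
  | not φ => not (φ.mono h)
  | conj ι φ => conj ι fun i => (φ i).mono h
  | ex x φ => ex x (φ.mono h)
  | quant Q hQ y hy ψ => quant Q (h hQ) y hy fun n R => (ψ n R).mono h

theorem free_mono {𝒬' : Set Quantifier} (h : 𝒬 ⊆ 𝒬') (φ : Formula σ 𝒬 k) :
    (φ.mono h).free = φ.free := by
  induction φ with
  | eq | rel => rfl
  | not φ ih => exact ih
  | conj ι φ ih => simp only [mono, free, ih]
  | ex x φ ih => simp only [mono, free, ih]
  | quant Q hQ y hy ψ ih => simp only [mono, free, ih]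

theorem realize_mono {𝒬' : Set Quantifier} (h : 𝒬 ⊆ 𝒬') (A : FinStr σ) (φ : Formula σ 𝒬 k) :
    ∀ α, (φ.mono h).Realize A α ↔ φ.Realize A α := by
  induction φ with
  | eq | rel => exact fun α => Iff.rfl
  | not φ ih => exact fun α => not_congr (ih α)
  | conj ι φ ih => exact fun α => forall_congr' fun i => ih i α
  | ex x φ ih => exact fun α => exists_congr fun a => ih _
  | quant Q hQ y hy ψ ih => intro α; simp only [mono, Realize, ih]

end Formula

theorem LogicLE.of_subset {𝒬 𝒬' : Set Quantifier} (h : 𝒬 ⊆ 𝒬') : LogicLE 𝒬 𝒬' :=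
  fun _ _ _ k φ hφ => ⟨k, φ.mono h, (φ.free_mono h).trans hφ, fun A =>
    forall_congr' fun α => (φ.realize_mono h A α).symm⟩

theorem nuCSPQuantifiers_mono (ℓ : ℕ) {r r' : ℕ} (h : r ≤ r') :
    nuCSPQuantifiers ℓ r ⊆ nuCSPQuantifiers ℓ r' :=
  fun _ hQ => ⟨hQ.1, hQ.2.1, fun n hn => (hQ.2.2 n hn).trans h⟩

/-! ### Bijective games -/

/-- A winning strategy for the duplicator in the `r`-bijective `m`-pebble game, as a relation
between positions. -/
structure BackAndForth {σ : FirstOrder.Language.{0, 0}} (A B : FinStr σ) (r m : ℕ)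
    (I : (Fin m → A.carrier) → (Fin m → B.carrier) → Prop) : Prop where
  eq_iff : ∀ α β, I α β → ∀ i j, α i = α j ↔ β i = β j
  rel_iff : ∀ α β, I α β → ∀ (n : ℕ) (R : σ.Relations n) (x : Fin n → Fin m),
    (fun i => α (x i)) ∈ A.relation R ↔ (fun i => β (x i)) ∈ B.relation R
  bij : ∀ α β, I α β → ∃ h : A.carrier ≃ B.carrier, ∀ n ≤ r, ∀ y : Fin n → Fin m,
    Function.Injective y → ∀ b : Fin n → A.carrier,
      I (Function.extend y b α) (Function.extend y (fun i => h (b i)) β)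

theorem withRel_mem_iff {σ : FirstOrder.Language.{0, 0}} {A B : FinStr σ} (Q : Quantifier)
    (h : A.carrier ≃ B.carrier)
    (a : ∀ n : ℕ, Q.voc.Relations n → Set (Fin n → A.carrier))
    (b : ∀ n : ℕ, Q.voc.Relations n → Set (Fin n → B.carrier))
    (hab : ∀ n R t, t ∈ a n R ↔ (fun i => h (t i)) ∈ b n R) :
    A.withRel Q.voc a ∈ Q.K ↔ B.withRel Q.voc b ∈ Q.K := by
  have e : (A.withRel Q.voc a).carrier ≃[Q.voc] (B.withRel Q.voc b).carrier :=
    { toEquiv := h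
      map_fun' := fun {_} f _ => isEmptyElim f
      map_rel' := fun {n} R t => (hab n R t).symm }
  exact ⟨Q.iso_closed _ _ ⟨e⟩, Q.iso_closed _ _ ⟨e.symm⟩⟩

/-- The bijection is an isomorphism between the structures defined by the subformulas of a
quantifier, as their tuples have length at most `r`. The existential quantifier is the case of
length one, whence `1 ≤ r`. -/
theorem BackAndForth.realize_iff {σ : FirstOrder.Language.{0, 0}} {A B : FinStr σ} {r m : ℕ}
    {I : (Fin m → A.carrier) → (Fin m → B.carrier) → Prop} (hI : BackAndForth A B r m I)
    (hr : 1 ≤ r) {𝒬 : Set Quantifier} (h𝒬 : ∀ Q ∈ 𝒬, Q.ArityLE r) (φ : Formula σ 𝒬 m) :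
    ∀ α β, I α β → (φ.Realize A α ↔ φ.Realize B β) := by
  induction φ with
  | eq x y => exact fun α β h => hI.eq_iff α β h x y
  | rel R x => exact fun α β h => hI.rel_iff α β h _ R x
  | not φ ih => exact fun α β h => not_congr (ih α β h)
  | conj ι φ ih => exact fun α β h => forall_congr' fun i => ih i α β h
  | ex x φ ih =>
    intro α β h
    obtain ⟨p, hp⟩ := hI.bij α β h
    have hext : ∀ {X : Type} (γ : Fin m → X) (a : X),
        Function.extend (fun _ : Fin 1 => x) (fun _ => a) γ = Function.update γ x a := by
      intro X γ a
      funext i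
      by_cases hi : i = x
      · subst hi
        rw [Function.update_self]
        exact Function.Injective.extend_apply (fun i j _ => Subsingleton.elim i j)
          (fun _ => a) γ (0 : Fin 1)
      · rw [Function.update_of_ne hi, Function.extend_apply']
        rintro ⟨_, h⟩
        exact hi h.symm
    have key : ∀ a, φ.Realize A (Function.update α x a) ↔
        φ.Realize B (Function.update β x (p a)) := by
      intro a
      have := hp 1 hr (fun _ => x) (fun i j _ => Subsingleton.elim i j) fun _ => a
      rw [hext, hext] at this
      exact ih _ _ this
    exact ⟨fun ⟨a, ha⟩ => ⟨p a, (key a).1 ha⟩, fun ⟨b, hb⟩ => ⟨p.symm b, (key _).2 (by simpa)⟩⟩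
  | quant Q hQ y hy ψ ih =>
    intro α β h
    obtain ⟨p, hp⟩ := hI.bij α β h
    exact withRel_mem_iff Q p _ _ fun n R t =>
      ih n R _ _ (hp n (h𝒬 Q hQ n ⟨R⟩) _ (hy n R) t)

/-! ### The quantifier of a code -/

/-- Relation symbols of arity `n`, one for each coset representative. -/
inductive CosetSymbol (n : ℕ) (F : Type) : ℕ → Type
  | mk (c : Fin n → F) : CosetSymbol n F n

/-- The vocabulary with the symbols `CosetSymbol n F`. -/
def cosetLanguage (n : ℕ) (F : Type) : FirstOrder.Language.{0, 0} := ⟨fun _ => Empty, CosetSymbol n F⟩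

instance (n : ℕ) (F : Type) : (cosetLanguage n F).IsRelational := fun _ =>
  (inferInstance : IsEmpty Empty)

instance (n : ℕ) (F : Type) [Finite F] : Finite (Σ k : ℕ, (cosetLanguage n F).Relations k) := by
  refine Finite.of_surjective
    (fun c : Fin n → F => (⟨n, CosetSymbol.mk c⟩ : Σ k, (cosetLanguage n F).Relations k)) ?_
  rintro ⟨_, ⟨c⟩⟩
  exact ⟨c, rfl⟩

/-- The symbol for the coset of `c`. -/
def cosetRel {n : ℕ} {F : Type} (c : Fin n → F) : (cosetLanguage n F).Relations n :=
  CosetSymbol.mk c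

/-- The variables of the sentence defining `CSP (cosetTemplate R)`. -/
def cosetVars {n : ℕ} {F : Type} : ∀ k : ℕ, (cosetLanguage n F).Relations k → Fin k → Fin n
  | _, .mk _ => id

theorem cosetVars_injective {n : ℕ} {F : Type} (k : ℕ) (s : (cosetLanguage n F).Relations k) :
    Function.Injective (cosetVars k s) := by
  cases s
  exact Function.injective_id

section CodeQuantifier

variable {F : Type} [AddCommGroup F] [Finite F] {n : ℕ} (R : AddSubgroup (Fin n → F))

/-- The structure on `F` whose relations are the cosets of `R`. -/
def cosetTemplate : FinStr (cosetLanguage n F) where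
  carrier := F
  str :=
    { funMap := fun {_} f _ => isEmptyElim f
      RelMap := fun {_} s => match s with
        | .mk c => fun x => x - c ∈ R }
  finite := inferInstance
  nonempty := ⟨0⟩

theorem mem_CSP_cosetTemplate (A : FinStr (cosetLanguage n F)) :
    A ∈ CSP (cosetTemplate R) ↔ ∃ h : A.carrier → F, ∀ (c : Fin n → F) (x : Fin n → A.carrier),
      x ∈ A.relation (cosetRel c) → (fun i => h (x i)) - c ∈ R := by
  constructor
  · rintro ⟨h⟩
    exact ⟨h, fun c x hx => h.map_rel' (cosetRel c) x hx⟩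
  · rintro ⟨h, hh⟩
    refine ⟨⟨h, fun {_} f _ => isEmptyElim f, ?_⟩⟩
    rintro _ ⟨c⟩ x hx
    exact hh c x hx

/-- The CSP quantifier of `cosetTemplate R`. -/
def cosetQuantifier : Quantifier where
  voc := cosetLanguage n F
  relational := inferInstance
  finite := inferInstance
  K := CSP (cosetTemplate R)
  iso_closed := fun _ _ ⟨e⟩ ⟨h⟩ => ⟨h.comp e.symm.toHom⟩

theorem near_of_mem_nearUnanimity {ℓ : ℕ} (hℓ : 3 ≤ ℓ) {A : Type} {a : Fin ℓ → A} {b : A}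
    (h : b ∈ nearUnanimity ℓ A a) {i j : Fin ℓ} (hij : i ≠ j) : a i = b ∨ a j = b := by
  rw [mem_nearUnanimity hℓ] at h
  by_contra! hne
  have hd : Disjoint {i : Fin ℓ | a i = b} {i, j} := by
    rw [Set.disjoint_left]
    rintro x hx (rfl | rfl)
    exacts [hne.1 hx, hne.2 hx]
  have h1 := Set.ncard_union_eq hd (Set.toFinite _) (Set.toFinite _)
  rw [Set.ncard_pair hij] at h1
  have h2 := Set.ncard_le_card ({i : Fin ℓ | a i = b} ∪ {i, j})
  rw [Nat.card_eq_fintype_card, Fintype.card_fin] at h2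
  omega

/-- A homomorphism to the template stays one after adding near-unanimity results, because cosets are
closed under them; three of the `ℓ` rows suffice. -/
theorem cosetQuantifier_mem {K ℓ : ℕ} (hR : IsMDS K R) (hn : 3 * K ≤ n) (hℓ : 3 ≤ ℓ) :
    cosetQuantifier R ∈ nuCSPQuantifiers ℓ n := by
  refine ⟨⟨cosetTemplate R, rfl⟩, ?_, ?_⟩
  · intro (B : FinStr (cosetLanguage n F)) hB rel hrel
    obtain ⟨h, hh⟩ := (mem_CSP_cosetTemplate R B).1 hB
    refine (mem_CSP_cosetTemplate R (B.withRel (cosetLanguage n F) rel)).2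
      ⟨h, fun c x hx => ?_⟩
    rcases hrel n (cosetRel c) hx with hx | ⟨M, hM, hxM⟩
    · exact hh c x hx
    · refine hR.mem_of_near hn c _ (fun a i => h (M (Fin.castLE hℓ a) i))
        (fun a => hh c _ (hM _)) fun j a b hab => ?_
      exact (near_of_mem_nearUnanimity hℓ (hxM j) (fun h => hab (Fin.castLE_injective hℓ h))).imp
        (congrArg h) (congrArg h)
  · rintro _ ⟨⟨c⟩⟩
    exact le_rfl

/-- The sentence defining `CSP (cosetTemplate R)`. -/
def cosetSentence {𝒬 : Set Quantifier} (h : cosetQuantifier R ∈ 𝒬) :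
    Formula (cosetLanguage n F) 𝒬 n :=
  .quant (cosetQuantifier R) h cosetVars cosetVars_injective fun k s => .rel s (cosetVars k s)

theorem isSentence_cosetSentence {𝒬 : Set Quantifier} (h : cosetQuantifier R ∈ 𝒬) :
    (cosetSentence R h).IsSentence := by
  simp [Formula.IsSentence, cosetSentence, Formula.free]

theorem cosetSentence_holds_iff {𝒬 : Set Quantifier} (h : cosetQuantifier R ∈ 𝒬)
    (A : FinStr (cosetLanguage n F)) :
    (cosetSentence R h).Holds A ↔ A ∈ CSP (cosetTemplate R) := by
  have key : ∀ α, (cosetSentence R h).Realize A α ↔ A ∈ CSP (cosetTemplate R) := by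
    intro α
    let rel : ∀ k, (cosetLanguage n F).Relations k → Set (Fin k → A.carrier) := fun k s =>
      {b | (fun i => Function.extend (cosetVars k s) b α (cosetVars k s i)) ∈ A.relation s}
    have hrel : ∀ k s, rel k s = A.relation s := by
      intro k s
      ext b
      have : (fun i => Function.extend (cosetVars k s) b α (cosetVars k s i)) = b :=
        funext fun i => (cosetVars_injective k s).extend_apply _ _ _
      simp only [rel, Set.mem_ofPred_eq, this]
    change A.withRel (cosetLanguage n F) rel ∈ CSP (cosetTemplate R) ↔ _
    rw [mem_CSP_cosetTemplate, mem_CSP_cosetTemplate]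
    refine exists_congr fun p => forall₂_congr fun c x => imp_congr_left ?_
    rw [← hrel n (cosetRel c)]
    rfl
  exact ⟨fun H => (key _).1 (H fun _ => Classical.arbitrary _), fun H α => (key α).2 H⟩

/-! ### Structures encoding systems of constraints -/

variable {E V : Type} [Finite V] [Nonempty V] (f : E → Fin n → V) (d : E → Fin n → F)

/-- The structure on `V × F` encoding the system of constraints with right-hand sides `d`. -/
def systemStr : FinStr (cosetLanguage n F) where
  carrier := V × F
  str :=
    { funMap := fun {_} f _ => isEmptyElim f
      RelMap := fun {_} s => match s with
        | .mk c => fun x => ∃ e, (∀ i, (x i).1 = f e i) ∧ (fun i => (x i).2) - d e - c ∈ R }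
  finite := inferInstance
  nonempty := ⟨(Classical.arbitrary V, 0)⟩

theorem mem_relation_systemStr (c : Fin n → F) (x : Fin n → V × F) :
    x ∈ (systemStr R f d).relation (cosetRel c) ↔
      ∃ e, (∀ i, (x i).1 = f e i) ∧ (fun i => (x i).2) - d e - c ∈ R :=
  Iff.rfl

theorem systemStr_zero_mem : systemStr R f 0 ∈ CSP (cosetTemplate R) := by
  rw [mem_CSP_cosetTemplate]
  refine ⟨fun q => q.2, fun c x hx => ?_⟩
  obtain ⟨e, -, hx⟩ := hx
  rw [Pi.zero_apply, sub_zero] at hx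
  exact hx

theorem systemStr_notMem (hd : ∀ z : V → F, ∃ e, ¬ Sat f R d z e) :
    systemStr R f d ∉ CSP (cosetTemplate R) := by
  intro hmem
  obtain ⟨h, hh⟩ := (mem_CSP_cosetTemplate R _).1 hmem
  let h' : V × F → F := h
  -- The tuple over `e` with second coordinates `0` lies in the relation of `-d e`, so a
  -- homomorphism restricted to the zero section solves the system up to sign.
  obtain ⟨e, he⟩ := hd fun v => - h' (v, 0)
  refine he ?_
  have h1 : (fun i => h' (f e i, 0)) - (- d e) ∈ R := by
    refine hh (- d e) (fun i => (f e i, 0)) ⟨e, fun i => rfl, ?_⟩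
    have : (fun _ => 0) - d e - - d e = (0 : Fin n → F) := by
      funext i
      simp
    exact this ▸ R.zero_mem
  have h2 := R.neg_mem h1
  rw [Sat]
  convert h2 using 1
  funext i
  simp [sub_eq_add_neg, add_comm]

variable [DecidableEq E] [DecidableEq V]

/-- The positions in which the pebbles differ by the values of an extendable assignment. -/
def ShiftPosition (m : ℕ) (α β : Fin m → V × F) : Prop :=
  ∃ x : V → F, Extendable f R d (Finset.univ.image fun i => (α i).1) x ∧
    ∀ i, β i = ((α i).1, (α i).2 + x (α i).1)

theorem backAndForth_systemStr [Finite E] {r m : ℕ} (hn : 0 < n) (hR : IsMDS (r + 4) R)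
    (hf : Expanding f (4 * m)) :
    BackAndForth (systemStr R f 0) (systemStr R f d) r m (ShiftPosition R f d m) := by
  refine ⟨?_, ?_, ?_⟩
  · rintro α β ⟨x, -, hβ⟩ i j
    constructor
    · intro h
      rw [hβ, hβ, h]
    · intro h
      have h' := ((hβ i).symm.trans h).trans (hβ j)
      obtain ⟨h1, h2⟩ := Prod.mk.inj h'
      rw [h1] at h2
      exact Prod.ext h1 (add_right_cancel h2)
  · rintro α β ⟨x, hx, hβ⟩ _ ⟨c⟩ p
    refine (mem_relation_systemStr R f 0 c _).trans
      (Iff.trans ?_ (mem_relation_systemStr R f d c _).symm)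
    refine exists_congr fun e => ?_
    have h1 : (∀ i, (β (p i)).1 = f e i) ↔ ∀ i, (α (p i)).1 = f e i := by simp only [hβ]
    rw [h1]
    refine and_congr_right fun hp => ?_
    have hmem : ∀ i, f e i ∈ Finset.univ.image fun i => (α i).1 := fun i =>
      Finset.mem_image.2 ⟨p i, Finset.mem_univ _, hp i⟩
    have hpos := Finset.card_pos.2 ⟨_, hmem ⟨0, hn⟩⟩
    -- All variables of `e` are pebbled, so `x` itself satisfies `e`, and the shift changes the
    -- residual by a codeword.
    obtain ⟨z, hz, hsat⟩ := hx {e} (by rw [Finset.card_singleton]; omega)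
    have hs : (fun i => z (f e i)) - d e ∈ R := hsat e (Finset.mem_singleton_self e)
    have e1 : (fun i => (β (p i)).2) - d e - c =
        ((fun i => (α (p i)).2) - (0 : E → Fin n → F) e - c) +
          ((fun i => z (f e i)) - d e) := by
      funext i
      simp only [Pi.sub_apply, Pi.add_apply, Pi.zero_apply, hβ, hp, hz _ (hmem i)]
      abel
    change _ ↔ (fun i => (β (p i)).2) - d e - c ∈ R
    rw [e1]
    exact (R.add_mem_cancel_right hs).symm
  · rintro α β ⟨x, hx, hβ⟩
    obtain ⟨y, hyx, hy⟩ := hx.exists_extension f R d hR hf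
      (Finset.card_image_le.trans (by simp))
    let h : V × F ≃ V × F :=
      { toFun := fun q => (q.1, q.2 + y q.1)
        invFun := fun q => (q.1, q.2 - y q.1)
        left_inv := fun q => by simp
        right_inv := fun q => by simp }
    refine ⟨h, fun k hk p hp b => ⟨y, ?_, ?_⟩⟩
    · refine hy (Finset.univ.image fun i => (b i).1)
        ((Finset.card_image_le.trans (by simp)).trans hk) _ ?_
        (Finset.card_image_le.trans (by simp))
      intro v hv
      obtain ⟨i, -, rfl⟩ := Finset.mem_image.1 hv
      by_cases hi : ∃ j, p j = i
      · obtain ⟨j, rfl⟩ := hi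
        refine Finset.mem_union_right _ (Finset.mem_image.2 ⟨j, Finset.mem_univ _, ?_⟩)
        rw [hp.extend_apply]
      · refine Finset.mem_union_left _ (Finset.mem_image.2 ⟨i, Finset.mem_univ _, ?_⟩)
        rw [Function.extend_apply' _ _ _ hi]
    · intro i
      by_cases hi : ∃ j, p j = i
      · obtain ⟨j, rfl⟩ := hi
        rw [hp.extend_apply, hp.extend_apply]
        rfl
      · rw [Function.extend_apply' _ _ _ hi, Function.extend_apply' _ _ _ hi, hβ,
          hyx _ (Finset.mem_image.2 ⟨i, Finset.mem_univ _, rfl⟩)]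

end CodeQuantifier

/-! ### Separation of the logics and the hierarchy -/

/-- The quantifier of a code of dimension `r + 4` is not definable by `r`-ary quantifiers. -/
theorem not_logicLE_of_isMDS {F : Type} [AddCommGroup F] [Finite F] [Nontrivial F] {n r : ℕ}
    (R : AddSubgroup (Fin n → F)) (hR : IsMDS (r + 4) R) (hn : r + 6 ≤ n) (hr : 1 ≤ r)
    {𝒬 𝒬' : Set Quantifier} (h𝒬 : ∀ Q ∈ 𝒬, Q.ArityLE r) (h𝒬' : cosetQuantifier R ∈ 𝒬') :
    ¬ LogicLE 𝒬' 𝒬 := by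
  intro hle
  obtain ⟨m, φ, hφ, heq⟩ := hle (cosetLanguage n F) inferInstance inferInstance n
    (cosetSentence R h𝒬') (isSentence_cosetSentence R h𝒬')
  obtain ⟨N, hN, f, hf⟩ := exists_expanding n (4 * m) (by omega)
  have : Nonempty (Fin N) := ⟨⟨0, hN⟩⟩
  obtain ⟨d, hd⟩ := exists_unsatisfiable f R hR (by omega) rfl (by simpa using hN)
  have h0 : φ.Holds (systemStr R f 0) :=
    (heq _).1 ((cosetSentence_holds_iff R h𝒬' _).2 (systemStr_zero_mem R f))
  have h1 : ¬ φ.Holds (systemStr R f d) := fun h =>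
    systemStr_notMem R f d hd ((cosetSentence_holds_iff R h𝒬' _).1 ((heq _).2 h))
  have hempty : Extendable f R d ∅ 0 := fun S hS => by
    rw [Finset.card_empty, mul_zero, Nat.le_zero, Finset.card_eq_zero] at hS
    subst hS
    exact ⟨0, by simp, by simp⟩
  -- The empty position is trivially extendable; one round from it supplies a starting position with
  -- all pebbles on a single element over `v`.
  obtain ⟨y, -, hy⟩ := hempty.exists_extension f R d hR hf (by simp)
  let v : Fin N := ⟨0, hN⟩
  have hpos : ShiftPosition R f d m (fun _ => (v, 0)) (fun _ => (v, y v)) := by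
    refine ⟨y, hy {v} (by simpa using hr) _ ?_ (Finset.card_image_le.trans (by simp)), by simp⟩
    intro w hw
    obtain ⟨_, -, rfl⟩ := Finset.mem_image.1 hw
    simp
  have := (backAndForth_systemStr R f d (by omega) hR hf).realize_iff hr h𝒬 φ _ _ hpos
  exact h1 ((hφ.holds_iff _ _).2 (this.1 ((hφ.holds_iff _ _).1 h0)))

theorem exists_logicLT (ℓ r : ℕ) (hℓ : 3 ≤ ℓ) (hr : 1 ≤ r) :
    ∃ r' : ℕ, r < r' ∧ LogicLT (nuCSPQuantifiers ℓ r) (nuCSPQuantifiers ℓ r') := by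
  obtain ⟨p, hp, hprime⟩ := Nat.exists_infinite_primes (3 * (r + 4))
  have : Fact p.Prime := ⟨hprime⟩
  obtain ⟨α⟩ : Nonempty (Fin (3 * (r + 4)) ↪ ZMod p) :=
    Function.Embedding.nonempty_of_card_le (by simpa [ZMod.card] using hp)
  obtain ⟨R, hR⟩ := exists_isMDS α (r + 4)
  refine ⟨3 * (r + 4), by omega, .of_subset (nuCSPQuantifiers_mono ℓ (by omega)), ?_⟩
  exact not_logicLE_of_isMDS R hR (by omega) hr (fun Q hQ => hQ.2.2)
    (cosetQuantifier_mem R hR le_rfl hℓ)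

end GenQuant

theorem mainTheorem12 (ℓ r : ℕ) (hℓ : 3 ≤ ℓ) (hr : ℓ ≤ r) :
    (∃ r' : ℕ, r < r' ∧
      GenQuant.LogicLT (GenQuant.nuCSPQuantifiers ℓ r) (GenQuant.nuCSPQuantifiers ℓ r')) ∧
    (∃ f : ℕ → ℕ, f 0 = r ∧ StrictMono f ∧ ∀ n : ℕ,
      GenQuant.LogicLT (GenQuant.nuCSPQuantifiers ℓ (f n))
        (GenQuant.nuCSPQuantifiers ℓ (f (n + 1)))) := by
  refine ⟨GenQuant.exists_logicLT ℓ r hℓ (by omega), ?_⟩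
  -- `next` is controlled only at arguments at least `1`, hence `hpos` along the iteration.
  choose! next hlt hLT using fun s (hs : 1 ≤ s) => GenQuant.exists_logicLT ℓ s hℓ hs
  let f : ℕ → ℕ := fun n => next^[n] r
  have hsucc : ∀ n, f (n + 1) = next (f n) := fun n => Function.iterate_succ_apply' next n r
  have hpos : ∀ n, 1 ≤ f n := by
    intro n
    induction n with
    | zero => exact (show 1 ≤ r by omega)
    | succ n ih => exact hsucc n ▸ ih.trans (hlt _ ih).le
  refine ⟨f, rfl, strictMono_nat_of_lt_succ fun n => hsucc n ▸ hlt _ (hpos n), fun n => ?_⟩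
  rw [hsucc]
  exact hLT _ (hpos n)
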